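/- Let $n,m\in\mathbb N$, $g_1,\dots,g_m\in\mathbb R[x_1,\dots,x_n]$, $b\in\mathbb R^m$, and suppose that $\Omega=\{x\in\mathbb R^n: g_k(x)\le b_k,\ k=1,\dots,m\}$ is compact. Let $\Omega_k=\{x\in\Omega: g_k(x)=b_k\}$ and suppose that $\nabla g_k(x)\ne 0$ for all $x\in\Omega_k$, $k=1,\dots,m$. Let $\sigma$ be the $(n-1)$-dimensional Hausdorff measure on $\partial\Omega$. Fix $j\in\{1,\dots,m\}$, let $\sigma_j$ be the restriction of $\sigma$ to $\Omega_j$, let $d\phi_j=\|\nabla g_j\|^{-1}\,d\sigma_j$, and let $v_\alpha=\int_{\Omega_j}x^\alpha\,d\phi_j$ for $\alpha\in\mathbb N^n$. Let $\tau\in\mathbb R$ be such that $\tau>\|\nabla g_j(x)\|^2$ for all $x\in\Omega_j$, let $\theta_j(x,z)=z^2-\|\nabla g_j(x)\|^2\in\mathbb R[x,z]$ and $\ell_j=\tfrac12\deg\theta_j$. For a vector $u=(u_{\alpha,k})_{|\alpha|+k\le 2d}$ let $L_u$ be the linear functional on polynomials in $(x,z)$ of degree at most $2d$ with $L_u(x^\alpha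 z^k)=u_{\alpha,k}$. For a polynomial $p$ in $(x,z)$ and $r\in\mathbb N$ with $2r+\deg p\le 2d$, let $M_r(p\,u)$ be the matrix with rows and columns indexed by the exponents $\beta,\gamma\in\mathbb N^{n+1}$ of degree at most $r$ and with entries $L_u(p\cdot (x,z)^{\beta+\gamma})$, and let $M_r(u)=M_r(1\,u)$. Consider, for each $d$, the set $F_d$ of all $u=(u_{\alpha,k})_{|\alpha|+k\le 2d}$ with $$u_{\alpha,0}=v_\alpha\ (|\alpha|\le 2d),\quad M_d(u)\succeq0,\quad M_{d-\ell_j}(\theta_j\,u)=0,\quad M_{d-1}((\tau-z^2)\,u)\succeq0,\quad M_{d-1}(z\,u)\succeq0,$$ and the semidefinite programs $\overline\rho_{j,d}=\sup\{u_{0,1}:u\in F_d\}$ and $\underline\rho_{j,d}=\inf\{u_{0,1}:u\in F_d\}$. Let $d_{\min}=\max\{1,\lceil\deg g_1/2\rceil,\dots,\lceil\deg g_m/2\rceil,\ell_j\}$. Suppose that these programs are feasible, i.e. $F_d\neq\emptyset$, for every $d\ge d_{\min}$. Then $\sigma_j(\Omega_j)<\infty$, and for every $d\ge d_{\min}$ the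 maximization program and the minimization program both have an optimal solution. For any choice of optimal solutions $u^d$ of the maximization programs and $w^d$ of the minimization programs ($d\ge d_{\min}$), $$\lim_{d\to\infty}u^d_{\alpha,1}=\lim_{d\to\infty}w^d_{\alpha,1}=\int_{\Omega_j}x^\alpha\,d\sigma_j\qquad\text{for all }\alpha\in\mathbb N^n.$$ In particular, for $d\ge d_{\min}$, $\overline\rho_{j,d}=u^d_{0,1}$ is nonincreasing in $d$ and $\underline\rho_{j,d}=w^d_{0,1}$ is nondecreasing in $d$, and both converge to $\sigma_j(\Omega_j)$ as $d\to\infty$. -/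

import Mathlib

open MeasureTheory Filter Topology

noncomputable section

namespace BoundaryMoments

/-! ### Riesz functional, moment and localizing matrices -/

/-- The Riesz functional `L_u(p) = ∑_β p_β u_β` of a real sequence `u` indexed by exponents. -/
def riesz {ι : Type*} (u : (ι →₀ ℕ) → ℝ) (p : MvPolynomial ι ℝ) : ℝ :=
  ∑ β ∈ p.support, p.coeff β * u β

/-- The localizing matrix `M_r(p u)`: rows and columns are indexed by the exponents of degree at
most `r`, and the entry at `(β, γ)` is `L_u(p X^(β+γ))`. -/
def localizingMatrix {ι : Type*} (r : ℕ) (p : MvPolynomial ι ℝ) (u : (ι →₀ ℕ) → ℝ) :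
    Matrix {β : ι →₀ ℕ // β.degree ≤ r} {β : ι →₀ ℕ // β.degree ≤ r} ℝ :=
  Matrix.of fun β γ => riesz u (p * MvPolynomial.monomial (β.1 + γ.1) 1)

/-- The moment matrix `M_r(u)`. -/
def momentMatrix {ι : Type*} (r : ℕ) (u : (ι →₀ ℕ) → ℝ) :
    Matrix {β : ι →₀ ℕ // β.degree ≤ r} {β : ι →₀ ℕ // β.degree ≤ r} ℝ :=
  localizingMatrix r 1 u

/-- The moment `∫ x^α dμ`. -/
def moment {n : ℕ} (μ : Measure (EuclideanSpace ℝ (Fin n))) (α : Fin n →₀ ℕ) : ℝ :=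
  ∫ x, ∏ i, x i ^ α i ∂μ

/-! ### The semi-algebraic set and its boundary measures -/

/-- `Ω = {x : g_k(x) ≤ b_k for all k}`. -/
def semialgSet {n m : ℕ} (g : Fin m → MvPolynomial (Fin n) ℝ) (b : Fin m → ℝ) :
    Set (EuclideanSpace ℝ (Fin n)) :=
  {x | ∀ k, MvPolynomial.eval (fun i => x i) (g k) ≤ b k}

/-- `Ω_j = {x ∈ Ω : g_j(x) = b_j}`. -/
def boundaryPiece {n m : ℕ} (g : Fin m → MvPolynomial (Fin n) ℝ) (b : Fin m → ℝ) (j : Fin m) :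
    Set (EuclideanSpace ℝ (Fin n)) :=
  {x | x ∈ semialgSet g b ∧ MvPolynomial.eval (fun i => x i) (g j) = b j}

/-- The gradient `∇p(x)` of a polynomial. -/
def polyGrad {n : ℕ} (p : MvPolynomial (Fin n) ℝ) (x : EuclideanSpace ℝ (Fin n)) :
    EuclideanSpace ℝ (Fin n) :=
  WithLp.toLp 2 fun i => MvPolynomial.eval (fun k => x k) (MvPolynomial.pderiv i p)

/-- The `(n-1)`-dimensional Hausdorff measure on the topological boundary `∂Ω`
(normalized so that it is the usual length, area, etc.). -/
def sigma {n m : ℕ} (g : Fin m → MvPolynomial (Fin n) ℝ) (b : Fin m → ℝ) :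
    Measure (EuclideanSpace ℝ (Fin n)) :=
  (μHE[n - 1]).restrict (frontier (semialgSet g b))

/-- `σ_j`, the restriction of `σ` to `Ω_j`. -/
def sigmaPiece {n m : ℕ} (g : Fin m → MvPolynomial (Fin n) ℝ) (b : Fin m → ℝ) (j : Fin m) :
    Measure (EuclideanSpace ℝ (Fin n)) :=
  (sigma g b).restrict (boundaryPiece g b j)

/-- `φ_j`, given by `dφ_j = dσ_j / ‖∇g_j‖`. -/
def phiPiece {n m : ℕ} (g : Fin m → MvPolynomial (Fin n) ℝ) (b : Fin m → ℝ) (j : Fin m) :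
    Measure (EuclideanSpace ℝ (Fin n)) :=
  (sigmaPiece g b j).withDensity fun x => ENNReal.ofReal (1 / ‖polyGrad (g j) x‖)

/-! ### The lifted semidefinite programs

The variables `(x, z)` are indexed by `Option (Fin n)`: `some i` stands for `x_i` and `none`
for `z`. -/

/-- The exponent `(α, k)` of the monomial `x^α z^k`. -/
def liftExp {n : ℕ} (α : Fin n →₀ ℕ) (k : ℕ) : Option (Fin n) →₀ ℕ :=
  α.optionElim k

/-- The extra variable `z`. -/
def zVar (n : ℕ) : MvPolynomial (Option (Fin n)) ℝ :=
  MvPolynomial.X none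

/-- The polynomial `t(x) = ‖∇p(x)‖²`. -/
def gradSq {n : ℕ} (p : MvPolynomial (Fin n) ℝ) : MvPolynomial (Fin n) ℝ :=
  ∑ i, MvPolynomial.pderiv i p ^ 2

theorem eval_gradSq {n : ℕ} (p : MvPolynomial (Fin n) ℝ) (x : EuclideanSpace ℝ (Fin n)) :
    MvPolynomial.eval (fun i => x i) (gradSq p) = ‖polyGrad p x‖ ^ 2 := by
  simp [gradSq, polyGrad, EuclideanSpace.norm_sq_eq]

/-- `θ(x, z) = z² - ‖∇p(x)‖²`. -/
def theta {n : ℕ} (p : MvPolynomial (Fin n) ℝ) : MvPolynomial (Option (Fin n)) ℝ :=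
  zVar n ^ 2 - MvPolynomial.rename some (gradSq p)

/-- `ℓ = deg θ / 2`. -/
def ell {n : ℕ} (p : MvPolynomial (Fin n) ℝ) : ℕ :=
  (theta p).totalDegree / 2

/-- `max {1, r_1, …, r_m, ℓ_j}` with `r_k = ⌈deg g_k / 2⌉`. -/
def dMin {n m : ℕ} (g : Fin m → MvPolynomial (Fin n) ℝ) (j : Fin m) : ℕ :=
  max 1 (max (Finset.univ.sup fun k => ((g k).totalDegree + 1) / 2) (ell (g j)))

/-- The common feasible set of the two programs of order `d`. A vector
`(u_{α,k})_{|α|+k ≤ 2d}` is represented by its extension by zero to all exponents. -/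
structure IsFeasible {n : ℕ} (p : MvPolynomial (Fin n) ℝ) (τ : ℝ) (v : (Fin n →₀ ℕ) → ℝ)
    (d : ℕ) (u : (Option (Fin n) →₀ ℕ) → ℝ) : Prop where
  eq_zero : ∀ β, 2 * d < β.degree → u β = 0
  marginal : ∀ α : Fin n →₀ ℕ, α.degree ≤ 2 * d → u (liftExp α 0) = v α
  moment_psd : (momentMatrix d u).PosSemidef
  theta_zero : localizingMatrix (d - ell p) (theta p) u = 0
  bound_psd : (localizingMatrix (d - 1) (MvPolynomial.C τ - zVar n ^ 2) u).PosSemidef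
  z_psd : (localizingMatrix (d - 1) (zVar n) u).PosSemidef

/-- Optimal solutions of the program that maximizes `u_{0,1}`. -/
def IsOptimalSup {n : ℕ} (p : MvPolynomial (Fin n) ℝ) (τ : ℝ) (v : (Fin n →₀ ℕ) → ℝ)
    (d : ℕ) (u : (Option (Fin n) →₀ ℕ) → ℝ) : Prop :=
  IsFeasible p τ v d u ∧ ∀ u', IsFeasible p τ v d u' → u' (liftExp 0 1) ≤ u (liftExp 0 1)

/-- Optimal solutions of the program that minimizes `u_{0,1}`. -/
def IsOptimalInf {n : ℕ} (p : MvPolynomial (Fin n) ℝ) (τ : ℝ) (v : (Fin n →₀ ℕ) → ℝ)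
    (d : ℕ) (u : (Option (Fin n) →₀ ℕ) → ℝ) : Prop :=
  IsFeasible p τ v d u ∧ ∀ u', IsFeasible p τ v d u' → u (liftExp 0 1) ≤ u' (liftExp 0 1)

/-- The value of the maximization program. -/
def upperValue {n : ℕ} (p : MvPolynomial (Fin n) ℝ) (τ : ℝ) (v : (Fin n →₀ ℕ) → ℝ)
    (d : ℕ) : ℝ :=
  sSup ((fun u : (Option (Fin n) →₀ ℕ) → ℝ => u (liftExp 0 1)) '' {u | IsFeasible p τ v d u})

/-- The value of the minimization program. -/
def lowerValue {n : ℕ} (p : MvPolynomial (Fin n) ℝ) (τ : ℝ) (v : (Fin n →₀ ℕ) → ℝ)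
    (d : ℕ) : ℝ :=
  sInf ((fun u : (Option (Fin n) →₀ ℕ) → ℝ => u (liftExp 0 1)) '' {u | IsFeasible p τ v d u})

end BoundaryMoments

end

open BoundaryMoments

noncomputable section

namespace BoundaryMoments

/-! A feasible functional `L_u` behaves like integration against a measure in `(x, z)` whose
`x`-marginal is `φ_j`. The constraint `θ_j = 0` says `z² = ‖∇g_j‖²` and `z ≥ 0` selects the root `z
= ‖∇g_j‖`, so `u_{α,1}` should approach `∫ x^α ‖∇g_j‖ dφ_j = ∫ x^α dσ_j`.

This is made quantitative at finite order, without representing measures. By compactness `‖∇g_j‖ ≥ c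
> 0` on `Ω_j`, and Weierstrass approximation of `√(‖∇g_j‖ - c)` gives `q = s² + c` within `ε` of
`‖∇g_j‖`. With `W = z - q` and `R = ‖∇g_j‖² - q²`, one has `W R = z W² + (s W)² + c W² - θ_j W`.
Feasibility and Cauchy–Schwarz then give `c² L_u(W²) ≤ L_u(R²) = ∫ R² dφ_j = O(ε²)`
(`IsFeasible.sq_mul_rieszLin_sub_sq_le`). A second Cauchy–Schwarz bounds `L_u(x^α W)`, hence the
error in `u_{α,1}`, by `O(ε)` for every feasible `u` of large order
(`exists_bound_apply_liftExp_one`). Optimality plays no role in the convergence.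

Optimal solutions exist because the feasible sets are compact (`isCompact_setOf_isFeasible`); the
values are monotone because feasible vectors truncate to feasible vectors (`IsFeasible.truncate`).
Finiteness of `σ_j` comes from projecting the level set locally onto tangent hyperplanes. -/

/-! ### Level sets have locally finite Hausdorff measure -/

/-- A level set of a function with nonzero strict derivative at `x` has finite Hausdorff measure
of codimension one near `x`. -/
theorem exists_nhds_hausdorffMeasure_levelSet_lt_top {E : Type*} [NormedAddCommGroup E]
    [NormedSpace ℝ E] [FiniteDimensional ℝ E] [MeasurableSpace E] [BorelSpace E]
    {f : E → ℝ} {f' : E →L[ℝ] ℝ} {x : E} (hf : HasStrictFDerivAt f f' x) (hf' : f' ≠ 0) (b : ℝ) :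
    ∃ U ∈ 𝓝 x, μH[(Module.finrank ℝ E - 1 : ℕ)] ({y | f y = b} ∩ U) < ⊤ := by
  obtain ⟨v₀, hv₀⟩ : ∃ v, f' v ≠ 0 := by
    by_contra! h
    exact hf' (by ext y; simpa using h y)
  set v := (f' v₀)⁻¹ • v₀ with hv
  have hv1 : f' v = 1 := by simp [hv, hv₀]
  -- Projection onto the kernel of `f'` along `v`. Differences of nearby points of the level set
  -- almost lie in this kernel, so `P` hardly shortens them.
  let P : E →L[ℝ] LinearMap.ker (f' : E →ₗ[ℝ] ℝ) :=
    (ContinuousLinearMap.id ℝ E - f'.smulRight v).codRestrict _ (by intro w; simp [hv1])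
  have hP : ∀ w, ((P w : LinearMap.ker (f' : E →ₗ[ℝ] ℝ)) : E) = w - f' w • v := fun w => rfl
  have hrank : Module.finrank ℝ E - 1 = Module.finrank ℝ (LinearMap.ker (f' : E →ₗ[ℝ] ℝ)) := by
    have h0 : (f' : E →ₗ[ℝ] ℝ) ≠ 0 := by
      intro h
      exact hv₀ (by simpa using LinearMap.congr_fun h v₀)
    have := Module.Dual.finrank_ker_add_one_of_ne_zero (f := (f' : E →ₗ[ℝ] ℝ)) h0
    omega
  -- Chosen so that the `v`-component of `y - z` has norm at most `‖y - z‖ / 2`, which yields the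
  -- antilipschitz constant 2.
  have hε : (0 : ℝ) < 1 / (2 * (‖v‖ + 1)) := by positivity
  have hev := hf.isLittleO.def hε
  rw [Metric.eventually_nhds_iff] at hev
  obtain ⟨r, hr, hball⟩ := hev
  set T : Set E := {y | f y = b} ∩ Metric.ball x r with hT
  refine ⟨Metric.ball x r, Metric.ball_mem_nhds x hr, ?_⟩
  have hanti : AntilipschitzWith 2 (fun y : T => P y) := by
    refine AntilipschitzWith.of_le_mul_dist fun y z => ?_
    have hyz : dist (y.1, z.1) (x, x) < r := by
      rw [Prod.dist_eq]
      exact max_lt y.2.2 z.2.2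
    have h1 := hball hyz
    have h2 : f y.1 - f z.1 = 0 := by
      rw [show f y.1 = b from y.2.1, show f z.1 = b from z.2.1, sub_self]
    simp only [h2, zero_sub, norm_neg] at h1
    have h3 : ‖f' (y.1 - z.1)‖ * ‖v‖ ≤ 1 / 2 * ‖y.1 - z.1‖ := by
      calc ‖f' (y.1 - z.1)‖ * ‖v‖
          ≤ (1 / (2 * (‖v‖ + 1)) * ‖y.1 - z.1‖) * (‖v‖ + 1) := by gcongr; linarith
        _ = _ := by
          have : ‖v‖ + 1 ≠ 0 := by positivity
          field_simp
    have h4 : ‖y.1 - z.1‖ ≤ ‖P (y.1 - z.1)‖ + ‖f' (y.1 - z.1)‖ * ‖v‖ := by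
      have : y.1 - z.1 = (P (y.1 - z.1) : E) + f' (y.1 - z.1) • v := by rw [hP]; abel
      calc ‖y.1 - z.1‖ = ‖(P (y.1 - z.1) : E) + f' (y.1 - z.1) • v‖ := by rw [← this]
        _ ≤ _ := by
          refine (norm_add_le _ _).trans ?_
          rw [norm_smul, Submodule.coe_norm]
    rw [Subtype.dist_eq, dist_eq_norm, dist_eq_norm, ← map_sub]
    push_cast
    linarith
  have hbdd : Bornology.IsBounded (P '' T) := by
    refine P.lipschitz.isBounded_image ?_
    exact Metric.isBounded_ball.subset Set.inter_subset_right
  -- Up to a finite factor, the measure of `T` is controlled by that of a compact subset of the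
  -- kernel, whose dimension equals that of the Hausdorff measure.
  have hle := hanti.hausdorffMeasure_preimage_le
    (d := ((Module.finrank ℝ E - 1 : ℕ) : ℝ)) (by positivity) (closure (P '' T))
  have huniv : (fun y : T => P y) ⁻¹' closure (P '' T) = Set.univ :=
    Set.eq_univ_of_forall fun y => subset_closure ⟨y.1, y.2, rfl⟩
  rw [huniv] at hle
  have himg := (isometry_subtype_coe (s := T)).hausdorffMeasure_image
    (d := ((Module.finrank ℝ E - 1 : ℕ) : ℝ)) (Or.inl (by positivity)) Set.univ
  rw [Set.image_univ, Subtype.range_coe] at himg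
  rw [himg]
  refine hle.trans_lt (ENNReal.mul_lt_top ?_ ?_)
  · exact ENNReal.rpow_lt_top_of_nonneg (by positivity) (by simp)
  · rw [hrank]
    exact (Metric.isCompact_of_isClosed_isBounded isClosed_closure hbdd.closure).measure_lt_top

/-! ### Polynomial functions and finiteness of `σ_j` -/

theorem continuous_evalPoly {n : ℕ} (p : MvPolynomial (Fin n) ℝ) :
    Continuous fun x : EuclideanSpace ℝ (Fin n) => MvPolynomial.eval (fun i => x i) p :=
  (MvPolynomial.continuous_eval p).comp (by fun_prop)

theorem hasStrictFDerivAt_evalPoly {n : ℕ} (p : MvPolynomial (Fin n) ℝ)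
    (x : EuclideanSpace ℝ (Fin n)) :
    HasStrictFDerivAt (fun x : EuclideanSpace ℝ (Fin n) => MvPolynomial.eval (fun i => x i) p)
      (innerSL ℝ (polyGrad p x)) x := by
  have hadd : ∀ p q : MvPolynomial (Fin n) ℝ, polyGrad (p + q) x = polyGrad p x + polyGrad q x := by
    intro p q; ext i; simp [polyGrad]
  induction p using MvPolynomial.induction_on with
  | C a =>
    have h : polyGrad (MvPolynomial.C a) x = 0 := by ext i; simp [polyGrad]
    rw [h, map_zero]
    simpa using hasStrictFDerivAt_const a x
  | add p q hp hq =>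
    rw [hadd, map_add]
    simpa only [map_add] using hp.fun_add hq
  | mul_X p i hp =>
    have hX : HasStrictFDerivAt (fun x : EuclideanSpace ℝ (Fin n) => x i)
        (EuclideanSpace.proj i : EuclideanSpace ℝ (Fin n) →L[ℝ] ℝ) x :=
      (EuclideanSpace.proj i : EuclideanSpace ℝ (Fin n) →L[ℝ] ℝ).hasStrictFDerivAt
    simp only [map_mul, MvPolynomial.eval_X]
    refine (hp.fun_mul hX).congr_fderiv ?_
    have : polyGrad (p * MvPolynomial.X i) x = x i • polyGrad p x
        + MvPolynomial.eval (fun k => x k) p • EuclideanSpace.single i 1 := by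
      ext k
      by_cases hk : k = i
      · subst hk
        simp [polyGrad]
        ring
      · simp [polyGrad, hk]
    rw [this]
    ext y
    simp [EuclideanSpace.inner_single_left]
    ring

theorem continuous_polyGrad {n : ℕ} (p : MvPolynomial (Fin n) ℝ) : Continuous (polyGrad p) :=
  (PiLp.continuous_toLp 2 _).comp (continuous_pi fun _ => continuous_evalPoly _)

theorem isCompact_boundaryPiece {n m : ℕ} {g : Fin m → MvPolynomial (Fin n) ℝ} {b : Fin m → ℝ}
    (hcompact : IsCompact (semialgSet g b)) (j : Fin m) : IsCompact (boundaryPiece g b j) :=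
  hcompact.inter_right (isClosed_eq (continuous_evalPoly (g j)) continuous_const)

theorem sigmaPiece_boundaryPiece_lt_top {n m : ℕ} {g : Fin m → MvPolynomial (Fin n) ℝ}
    {b : Fin m → ℝ} (hcompact : IsCompact (semialgSet g b)) {j : Fin m}
    (hgrad : ∀ x ∈ boundaryPiece g b j, polyGrad (g j) x ≠ 0) :
    sigmaPiece g b j (boundaryPiece g b j) < ⊤ := by
  refine lt_of_le_of_lt (Measure.restrict_apply_le _ _) (lt_of_le_of_lt
    (Measure.restrict_apply_le _ _) ?_)
  rw [Measure.euclideanHausdorffMeasure_def, Measure.smul_apply]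
  refine ENNReal.mul_lt_top (by simp) ?_
  refine (isCompact_boundaryPiece hcompact j).measure_lt_top_of_nhdsWithin fun x hx => ?_
  have hne : innerSL ℝ (polyGrad (g j) x) ≠ 0 := by
    intro h
    refine hgrad x hx ?_
    have := congrArg (fun F => F (polyGrad (g j) x)) h
    simpa using this
  obtain ⟨U, hU, hlt⟩ := exists_nhds_hausdorffMeasure_levelSet_lt_top
    (hasStrictFDerivAt_evalPoly (g j) x) hne (b j)
  refine ⟨boundaryPiece g b j ∩ U, inter_mem self_mem_nhdsWithin (mem_nhdsWithin_of_mem_nhds hU), ?_⟩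
  rw [finrank_euclideanSpace_fin] at hlt
  exact lt_of_le_of_lt (measure_mono (Set.inter_subset_inter_left _ fun y hy => hy.2)) hlt

/-! ### The Riesz functional and positive semidefinite localizing matrices -/

/-- The Riesz functional as a linear map. -/
def rieszLin {ι : Type*} (u : (ι →₀ ℕ) → ℝ) : MvPolynomial ι ℝ →ₗ[ℝ] ℝ :=
  (MvPolynomial.basisMonomials ι ℝ).constr ℝ u

theorem rieszLin_apply {ι : Type*} (u : (ι →₀ ℕ) → ℝ) (p : MvPolynomial ι ℝ) :
    rieszLin u p = riesz u p := by
  simp only [rieszLin, Module.Basis.constr_apply, smul_eq_mul]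
  rfl

theorem rieszLin_monomial {ι : Type*} (u : (ι →₀ ℕ) → ℝ) (β : ι →₀ ℕ) (c : ℝ) :
    rieszLin u (MvPolynomial.monomial β c) = c * u β := by
  have : MvPolynomial.monomial β c = c • MvPolynomial.basisMonomials ι ℝ β := by
    simp [MvPolynomial.smul_monomial]
  rw [this, map_smul, rieszLin, Module.Basis.constr_basis, smul_eq_mul]

theorem continuous_rieszLin {ι : Type*} (p : MvPolynomial ι ℝ) :
    Continuous fun u : (ι →₀ ℕ) → ℝ => rieszLin u p := by
  simp only [rieszLin_apply, riesz]
  fun_prop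

theorem rieszLin_congr {ι : Type*} {u w : (ι →₀ ℕ) → ℝ} {p : MvPolynomial ι ℝ}
    (h : ∀ β : ι →₀ ℕ, β.degree ≤ p.totalDegree → u β = w β) : rieszLin u p = rieszLin w p := by
  simp only [rieszLin_apply, riesz]
  refine Finset.sum_congr rfl fun β hβ => ?_
  rw [h β (MvPolynomial.le_totalDegree hβ)]

theorem localizingMatrix_apply {ι : Type*} (r : ℕ) (p : MvPolynomial ι ℝ) (u : (ι →₀ ℕ) → ℝ)
    (β γ : {β : ι →₀ ℕ // β.degree ≤ r}) :
    localizingMatrix r p u β γ = rieszLin u (p * MvPolynomial.monomial (β.1 + γ.1) 1) := by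
  rw [rieszLin_apply]; rfl

theorem localizingMatrix_quadForm {ι : Type*} (r : ℕ) (p : MvPolynomial ι ℝ) (u : (ι →₀ ℕ) → ℝ)
    (x : {β : ι →₀ ℕ // β.degree ≤ r} →₀ ℝ) :
    (x.sum fun i xi => x.sum fun j xj => star xi * localizingMatrix r p u i j * xj)
      = rieszLin u (p * (∑ i ∈ x.support, MvPolynomial.monomial i.1 (x i)) ^ 2) := by
  rw [sq, Finset.sum_mul_sum, Finset.mul_sum, map_sum]
  refine Finset.sum_congr rfl fun i _ => ?_
  rw [Finset.mul_sum, map_sum]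
  refine Finset.sum_congr rfl fun j _ => ?_
  change star (x i) * localizingMatrix r p u i j * x j = _
  rw [localizingMatrix_apply, MvPolynomial.monomial_mul]
  have : MvPolynomial.monomial (i.1 + j.1) (x i * x j)
      = (x i * x j) • MvPolynomial.monomial (i.1 + j.1) (1 : ℝ) := by
    simp [MvPolynomial.smul_monomial]
  rw [this, mul_smul_comm, map_smul]
  simp
  ring

/-- The quadratic form of the matrix at the coefficient vector of `q` is `L_u(p q²)`. All
semidefinite constraints are used in this form. -/
theorem localizingMatrix_posSemidef_iff {ι : Type*} (r : ℕ) (p : MvPolynomial ι ℝ)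
    (u : (ι →₀ ℕ) → ℝ) : (localizingMatrix r p u).PosSemidef ↔
      ∀ q : MvPolynomial ι ℝ, q.totalDegree ≤ r → 0 ≤ rieszLin u (p * q ^ 2) := by
  constructor
  · intro h q hq
    have hsub : ∀ β ∈ q.support, β.degree ≤ r := fun β hβ =>
      (MvPolynomial.le_totalDegree hβ).trans hq
    let x : {β : ι →₀ ℕ // β.degree ≤ r} →₀ ℝ :=
      Finsupp.subtypeDomain (fun β : ι →₀ ℕ => β.degree ≤ r)
      (AddMonoidAlgebra.coeff q)
    have h2 := h.2 x
    rw [localizingMatrix_quadForm] at h2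
    have : ∑ i ∈ x.support, MvPolynomial.monomial i.1 (x i) = q := by
      have h3 := Finsupp.sum_subtypeDomain_index (p := fun β : ι →₀ ℕ => β.degree ≤ r)
        (v := AddMonoidAlgebra.coeff q) (h := fun β c => MvPolynomial.monomial β c) hsub
      refine Eq.trans h3 ?_
      exact q.support_sum_monomial_coeff
    rwa [this] at h2
  · intro h
    refine ⟨?_, fun x => ?_⟩
    · ext β γ
      simp only [Matrix.conjTranspose_apply, localizingMatrix_apply, star_trivial, add_comm]
    · rw [localizingMatrix_quadForm]
      refine h _ (MvPolynomial.totalDegree_finsetSum_le fun i _ => ?_)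
      exact (MvPolynomial.totalDegree_monomial_le _ _).trans i.2

theorem rieszLin_mul_eq_zero_of_localizingMatrix_eq_zero {ι : Type*} {r : ℕ}
    {p : MvPolynomial ι ℝ} {u : (ι →₀ ℕ) → ℝ} (h : localizingMatrix r p u = 0)
    {q : MvPolynomial ι ℝ} (hq : q.totalDegree ≤ r) : rieszLin u (p * q) = 0 := by
  rw [← q.support_sum_monomial_coeff, Finset.mul_sum, map_sum]
  refine Finset.sum_eq_zero fun β hβ => ?_
  -- The column of exponent 0 suffices, since `q` has degree at most `r` rather than `2r`.
  have h1 := congrFun (congrFun h ⟨β, (MvPolynomial.le_totalDegree hβ).trans hq⟩) ⟨0, by simp⟩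
  rw [localizingMatrix_apply] at h1
  have : MvPolynomial.monomial β (q.coeff β)
      = (q.coeff β) • MvPolynomial.monomial β (1 : ℝ) := by
    simp [MvPolynomial.smul_monomial]
  rw [this, mul_smul_comm, map_smul]
  simp only [add_zero, Matrix.zero_apply] at h1
  rw [h1, smul_zero]

/-- Cauchy–Schwarz for a functional with positive semidefinite moment matrix. -/
theorem rieszLin_mul_sq_le {ι : Type*} {d : ℕ} {u : (ι →₀ ℕ) → ℝ}
    (h : (momentMatrix d u).PosSemidef) {p q : MvPolynomial ι ℝ} (hp : p.totalDegree ≤ d)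
    (hq : q.totalDegree ≤ d) :
    rieszLin u (p * q) ^ 2 ≤ rieszLin u (p ^ 2) * rieszLin u (q ^ 2) := by
  -- The quadratic `t ↦ L_u((t p + q)²)` is nonnegative, so its discriminant is at most 0.
  have hd : ∀ t : ℝ, 0 ≤ rieszLin u (p ^ 2) * (t * t) + 2 * rieszLin u (p * q) * t
      + rieszLin u (q ^ 2) := by
    intro t
    have h1 := (localizingMatrix_posSemidef_iff d 1 u).1 h (t • p + q)
      ((MvPolynomial.totalDegree_add _ _).trans
        (max_le ((MvPolynomial.totalDegree_smul_le _ _).trans hp) hq))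
    have : 1 * (t • p + q) ^ 2 = (t * t) • p ^ 2 + (2 * t) • (p * q) + q ^ 2 := by
      simp only [MvPolynomial.smul_eq_C_mul, map_mul, map_ofNat]
      ring
    rw [this, map_add, map_add, map_smul, map_smul, smul_eq_mul, smul_eq_mul] at h1
    linarith
  have := discrim_le_zero hd
  rw [discrim] at this
  nlinarith

theorem rieszLin_sq_nonneg {ι : Type*} {d : ℕ} {u : (ι →₀ ℕ) → ℝ}
    (h : (momentMatrix d u).PosSemidef) {p : MvPolynomial ι ℝ} (hp : p.totalDegree ≤ d) :
    0 ≤ rieszLin u (p ^ 2) := by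
  simpa using (localizingMatrix_posSemidef_iff d 1 u).1 h p hp

/-- Halving an exponent lets Cauchy–Schwarz bound any entry of `u` by two entries at doubled
exponents. -/
theorem exists_add_eq_degree_le {ι : Type*} {d : ℕ} {β : ι →₀ ℕ} (h : β.degree ≤ 2 * d) :
    ∃ β₁ β₂ : ι →₀ ℕ, β₁ + β₂ = β ∧ β₁.degree ≤ d ∧ β₂.degree ≤ d := by
  obtain ⟨γ, hγ, hdeg⟩ := Finsupp.exists_le_degree_eq β (min d β.degree) (min_le_right _ _)
  refine ⟨γ, β - γ, add_tsub_cancel_of_le hγ, by omega, ?_⟩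
  have := congrArg Finsupp.degree (add_tsub_cancel_of_le hγ)
  rw [map_add] at this
  omega

/-! ### Sums of squares have even degree -/

/-- A polynomial that is nonnegative everywhere has even total degree. -/
theorem even_totalDegree_of_nonneg {n : ℕ} {f : MvPolynomial (Fin n) ℝ}
    (hf : ∀ x, 0 ≤ MvPolynomial.eval x f) : Even f.totalDegree := by
  by_contra hodd
  rw [Nat.not_even_iff_odd] at hodd
  set e := f.totalDegree with he
  have hpos : 0 < e := hodd.pos
  -- The top form is nonnegative: were it negative at `x`, the polynomial `P(t) = f(t x)` would have
  -- negative leading coefficient and tend to `-∞`.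
  have key : ∀ x, 0 ≤ MvPolynomial.eval x (MvPolynomial.homogeneousComponent e f) := by
    intro x
    let P : Polynomial ℝ := ∑ i ∈ Finset.range (e + 1), Polynomial.monomial i
      (MvPolynomial.eval x (MvPolynomial.homogeneousComponent i f))
    have hP : ∀ t, P.eval t = MvPolynomial.eval (fun i => t * x i) f := by
      intro t
      conv_rhs => rw [← MvPolynomial.sum_homogeneousComponent f]
      simp only [P, Polynomial.eval_finsetSum, map_sum, Polynomial.eval_monomial]
      refine Finset.sum_congr rfl fun i _ => ?_
      have hh := MvPolynomial.homogeneousComponent_isHomogeneous i f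
      rw [MvPolynomial.eval_eq', MvPolynomial.eval_eq', Finset.sum_mul]
      refine Finset.sum_congr rfl fun β hβ => ?_
      have hβ' := hh (MvPolynomial.mem_support_iff.1 hβ)
      have hdeg : ∑ k, β k = i := by
        rw [← Finsupp.degree_eq_sum, Finsupp.degree_eq_weight_one]; exact hβ'
      simp only [mul_pow, Finset.prod_mul_distrib, Finset.prod_pow_eq_pow_sum, hdeg]
      ring
    have hcoeff : ∀ k, k ≤ e → P.coeff k
        = MvPolynomial.eval x (MvPolynomial.homogeneousComponent k f) := by
      intro k hk
      simp [P, Polynomial.coeff_monomial, Nat.lt_succ_iff.2 hk]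
    by_contra! hneg
    have hne : P.coeff e ≠ 0 := by rw [hcoeff e le_rfl]; exact hneg.ne
    have hnat : P.natDegree = e := by
      refine le_antisymm ?_ (Polynomial.le_natDegree_of_ne_zero hne)
      refine Polynomial.natDegree_sum_le_of_forall_le _ _ fun i hi => ?_
      exact (Polynomial.natDegree_monomial_le _).trans (Nat.lt_succ_iff.1 (Finset.mem_range.1 hi))
    have hlim := P.tendsto_atBot_of_leadingCoeff_nonpos
      (Polynomial.natDegree_pos_iff_degree_pos.1 (by omega))
      (by rw [Polynomial.leadingCoeff, hnat, hcoeff e le_rfl]; exact hneg.le)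
    obtain ⟨t, ht⟩ := (hlim.eventually (eventually_lt_atBot 0)).exists
    rw [hP] at ht
    exact absurd (hf _) (not_le.2 ht)
  -- A form of odd degree changes sign under `x ↦ -x`, so nonnegativity forces it to vanish.
  have hzero : MvPolynomial.homogeneousComponent e f = 0 := by
    refine MvPolynomial.funext fun x => ?_
    rw [map_zero]
    refine le_antisymm ?_ (key x)
    have hh := MvPolynomial.homogeneousComponent_isHomogeneous e f
    have h1 := key (fun i => (-1) * x i)
    have : MvPolynomial.eval (fun i => (-1) * x i) (MvPolynomial.homogeneousComponent e f)
        = - MvPolynomial.eval x (MvPolynomial.homogeneousComponent e f) := by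
      rw [MvPolynomial.eval_eq', MvPolynomial.eval_eq', ← Finset.sum_neg_distrib]
      refine Finset.sum_congr rfl fun β hβ => ?_
      have hβ' := hh (MvPolynomial.mem_support_iff.1 hβ)
      have hdeg : ∑ k, β k = e := by
        rw [← Finsupp.degree_eq_sum, Finsupp.degree_eq_weight_one]; exact hβ'
      simp only [mul_pow, Finset.prod_mul_distrib, Finset.prod_pow_eq_pow_sum, hdeg,
        hodd.neg_one_pow]
      ring
    linarith
  have hfne : f ≠ 0 := by rintro rfl; simp [he] at hpos
  obtain ⟨β, hβ, hdeg⟩ := Finset.exists_mem_eq_sup f.support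
    (MvPolynomial.support_nonempty.2 hfne) (fun s : Fin n →₀ ℕ => s.sum fun _ e => e)
  have h1 : β.degree = e := hdeg.symm
  have h2 := congrArg (MvPolynomial.coeff β) hzero
  rw [MvPolynomial.coeff_homogeneousComponent, if_pos h1, MvPolynomial.coeff_zero] at h2
  exact MvPolynomial.mem_support_iff.1 hβ h2

theorem even_totalDegree_gradSq {n : ℕ} (p : MvPolynomial (Fin n) ℝ) :
    Even (gradSq p).totalDegree := by
  refine even_totalDegree_of_nonneg fun x => ?_
  simp only [gradSq, map_sum, map_pow]
  positivity

theorem totalDegree_rename_of_injective {ι κ : Type*} {f : ι → κ} (hf : Function.Injective f)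
    (p : MvPolynomial ι ℝ) : (MvPolynomial.rename f p).totalDegree = p.totalDegree := by
  refine le_antisymm (MvPolynomial.totalDegree_rename_le _ _) (Finset.sup_le fun β hβ => ?_)
  have h : Finsupp.mapDomain f β ∈ (MvPolynomial.rename f p).support := by
    rw [MvPolynomial.mem_support_iff, MvPolynomial.coeff_rename_mapDomain f hf]
    exact MvPolynomial.mem_support_iff.1 hβ
  have h1 := MvPolynomial.le_totalDegree h
  change (Finsupp.mapDomain f β).degree ≤ _ at h1
  rwa [Finsupp.degree_mapDomain] at h1

/-- The rounded division in `ell` loses nothing: `z²` cannot cancel against a polynomial in `x`, so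
the degree is `max 2 (deg ‖∇p‖²)`, and a sum of squares has even degree. -/
theorem totalDegree_theta_le {n : ℕ} (p : MvPolynomial (Fin n) ℝ) :
    (theta p).totalDegree ≤ 2 * ell p := by
  have hX : (zVar n ^ 2).totalDegree = 2 := MvPolynomial.totalDegree_X_pow none 2
  have hle : (theta p).totalDegree ≤ max 2 (gradSq p).totalDegree := by
    refine (MvPolynomial.totalDegree_sub _ _).trans ?_
    rw [hX]
    exact max_le_max le_rfl (MvPolynomial.totalDegree_rename_le _ _)
  have hge2 : 2 ≤ (theta p).totalDegree := by
    have hc : (theta p).coeff (Finsupp.single none 2) ≠ 0 := by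
      rw [theta, MvPolynomial.coeff_sub, zVar, MvPolynomial.coeff_X_pow, if_pos rfl,
        MvPolynomial.coeff_rename_eq_zero]
      · norm_num
      · intro β hβ
        have := congrArg (fun s => s none) hβ
        simp [Finsupp.mapDomain_of_notMem_range] at this
    have := MvPolynomial.le_totalDegree (MvPolynomial.mem_support_iff.2 hc)
    simpa using this
  have hge : (gradSq p).totalDegree ≤ max 2 (theta p).totalDegree := by
    have h1 : MvPolynomial.rename some (gradSq p) = zVar n ^ 2 - theta p := by rw [theta]; ring
    have h2 : (MvPolynomial.rename (some : Fin n → Option (Fin n)) (gradSq p)).totalDegree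
        = (gradSq p).totalDegree :=
      totalDegree_rename_of_injective (Option.some_injective _) _
    rw [← h2, h1]
    refine (MvPolynomial.totalDegree_sub _ _).trans ?_
    rw [hX]
  obtain ⟨k, hk⟩ := even_totalDegree_gradSq p
  rw [ell]
  omega

/-! ### The feasible sets -/

theorem liftExp_add {n : ℕ} (α β : Fin n →₀ ℕ) (k l : ℕ) :
    liftExp α k + liftExp β l = liftExp (α + β) (k + l) := by
  ext i
  cases i <;> simp [liftExp]

theorem single_none_eq_liftExp {n : ℕ} (k : ℕ) :
    (Finsupp.single none k : Option (Fin n) →₀ ℕ) = liftExp 0 k := by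
  rw [liftExp, Finsupp.optionElim_zero]

theorem liftExp_zero_eq_mapDomain {n : ℕ} (α : Fin n →₀ ℕ) :
    liftExp α 0 = Finsupp.mapDomain some α := by
  ext i
  cases i with
  | none => simp [liftExp, Finsupp.mapDomain_of_notMem_range]
  | some i =>
    rw [Finsupp.mapDomain_apply (Option.some_injective _), liftExp,
      Finsupp.optionElim_apply_some]

theorem degree_liftExp {n : ℕ} (α : Fin n →₀ ℕ) (k : ℕ) :
    (liftExp α k).degree = α.degree + k := by
  rw [Finsupp.degree_eq_sum, Finsupp.degree_eq_sum, Fintype.sum_option]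
  simp [liftExp, add_comm]

theorem exists_eq_liftExp {n : ℕ} (β : Option (Fin n) →₀ ℕ) : ∃ α k, β = liftExp α k :=
  ⟨β.some, β none, (Finsupp.optionElim_some β).symm⟩

theorem zVar_pow {n : ℕ} (k : ℕ) : zVar n ^ k = MvPolynomial.monomial (liftExp 0 k) 1 := by
  rw [zVar, MvPolynomial.X_pow_eq_monomial, single_none_eq_liftExp]

theorem totalDegree_zVar (n : ℕ) : (zVar n).totalDegree = 1 := MvPolynomial.totalDegree_X none

theorem totalDegree_bound_le {n : ℕ} (τ : ℝ) :
    (MvPolynomial.C τ - zVar n ^ 2).totalDegree ≤ 2 := by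
  refine (MvPolynomial.totalDegree_sub _ _).trans ?_
  rw [MvPolynomial.totalDegree_C, zVar, MvPolynomial.totalDegree_X_pow]
  simp

/-- The restriction of a sequence to the exponents of degree at most `2 d`. -/
def truncate {ι : Type*} (d : ℕ) (u : (ι →₀ ℕ) → ℝ) (β : ι →₀ ℕ) : ℝ :=
  if β.degree ≤ 2 * d then u β else 0

theorem rieszLin_truncate {ι : Type*} {d : ℕ} {u : (ι →₀ ℕ) → ℝ} {p : MvPolynomial ι ℝ}
    (hp : p.totalDegree ≤ 2 * d) : rieszLin (truncate d u) p = rieszLin u p :=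
  rieszLin_congr fun _ hβ => if_pos (hβ.trans hp)

theorem localizingMatrix_truncate_posSemidef {ι : Type*} {d r s : ℕ} {u : (ι →₀ ℕ) → ℝ}
    {p : MvPolynomial ι ℝ} (hp : p.totalDegree + 2 * r ≤ 2 * d) (hrs : r ≤ s)
    (h : (localizingMatrix s p u).PosSemidef) :
    (localizingMatrix r p (truncate d u)).PosSemidef := by
  rw [localizingMatrix_posSemidef_iff] at h ⊢
  intro q hq
  rw [rieszLin_truncate]
  · exact h q (hq.trans hrs)
  · have h1 := MvPolynomial.totalDegree_mul p (q ^ 2)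
    have h2 := MvPolynomial.totalDegree_pow q 2
    omega

theorem localizingMatrix_truncate_eq_zero {ι : Type*} {d r s : ℕ} {u : (ι →₀ ℕ) → ℝ}
    {p : MvPolynomial ι ℝ} (hp : p.totalDegree + 2 * r ≤ 2 * d) (hrs : r ≤ s)
    (h : localizingMatrix s p u = 0) : localizingMatrix r p (truncate d u) = 0 := by
  ext β γ
  have h1 := congrFun (congrFun h ⟨β, β.2.trans hrs⟩) ⟨γ, γ.2.trans hrs⟩
  rw [localizingMatrix_apply] at h1 ⊢
  rw [rieszLin_truncate]
  · exact h1
  · have h2 := MvPolynomial.totalDegree_mul p (MvPolynomial.monomial (β.1 + γ.1) 1)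
    have h3 := MvPolynomial.totalDegree_monomial_le (β.1 + γ.1) (1 : ℝ)
    have h4 : (β.1 + γ.1).degree = β.1.degree + γ.1.degree := map_add _ _ _
    have h5 := β.2
    have h6 := γ.2
    change _ ≤ (β.1 + γ.1).degree at h3
    omega

/-- The order-`d` constraints involve only entries of degree at most `2d`. The lower bounds on `d`
keep the natural-number subtractions `d - 1` and `d - ell p` from being cut off at 0. -/
theorem IsFeasible.truncate {n : ℕ} {p : MvPolynomial (Fin n) ℝ} {τ : ℝ}
    {v : (Fin n →₀ ℕ) → ℝ} {d e : ℕ} {u : (Option (Fin n) →₀ ℕ) → ℝ} (hu : IsFeasible p τ v e u)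
    (hde : d ≤ e) (hd : 1 ≤ d) (hell : ell p ≤ d) :
    IsFeasible p τ v d (truncate d u) where
  eq_zero β hβ := if_neg (not_le.2 hβ)
  marginal α hα := by
    have h : (liftExp α 0).degree ≤ 2 * d := by rwa [degree_liftExp]
    rw [BoundaryMoments.truncate, if_pos h]
    exact hu.marginal α (by omega)
  moment_psd := localizingMatrix_truncate_posSemidef (by simp) hde hu.moment_psd
  theta_zero := by
    refine localizingMatrix_truncate_eq_zero ?_ (by omega) hu.theta_zero
    have := totalDegree_theta_le p
    omega
  bound_psd := by
    refine localizingMatrix_truncate_posSemidef ?_ (by omega) hu.bound_psd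
    have := totalDegree_bound_le (n := n) τ
    omega
  z_psd := by
    refine localizingMatrix_truncate_posSemidef ?_ (by omega) hu.z_psd
    have := totalDegree_zVar n
    omega

/-! ### Bounds on feasible vectors and compactness -/

theorem IsFeasible.apply_even_nonneg {n : ℕ} {p : MvPolynomial (Fin n) ℝ} {τ : ℝ}
    {v : (Fin n →₀ ℕ) → ℝ} {d : ℕ} {u : (Option (Fin n) →₀ ℕ) → ℝ} (hu : IsFeasible p τ v d u)
    {β : Option (Fin n) →₀ ℕ} (hβ : β.degree ≤ d) : 0 ≤ u (β + β) := by
  have h := rieszLin_sq_nonneg hu.moment_psd (p := MvPolynomial.monomial β 1)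
    ((MvPolynomial.totalDegree_monomial_le _ _).trans hβ)
  rwa [sq, MvPolynomial.monomial_mul, rieszLin_monomial, one_mul, one_mul] at h

/-- Testing `τ - z²` against the square of `x^α z^k` trades a factor `z²` for `τ`; the induction
starts at the prescribed marginal. Using `|τ|` avoids a sign condition. -/
theorem IsFeasible.apply_even_le {n : ℕ} {p : MvPolynomial (Fin n) ℝ} {τ : ℝ}
    {v : (Fin n →₀ ℕ) → ℝ} {d : ℕ} {u : (Option (Fin n) →₀ ℕ) → ℝ} (hu : IsFeasible p τ v d u)
    (α : Fin n →₀ ℕ) (k : ℕ) (hk : α.degree + k ≤ d) :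
    u (liftExp α k + liftExp α k) ≤ |τ| ^ k * v (α + α) := by
  induction k with
  | zero =>
    rw [liftExp_add, hu.marginal _ (by rw [map_add]; omega)]
    simp
  | succ k ih =>
    have h := (localizingMatrix_posSemidef_iff _ _ _).1 hu.bound_psd
      (MvPolynomial.monomial (liftExp α k) 1)
      ((MvPolynomial.totalDegree_monomial_le _ _).trans
        (show (liftExp α k).degree ≤ d - 1 by rw [degree_liftExp]; omega))
    rw [sub_mul, sq (MvPolynomial.monomial _ _), MvPolynomial.monomial_mul, zVar_pow,
      MvPolynomial.monomial_mul, MvPolynomial.C_mul_monomial, map_sub, rieszLin_monomial,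
      rieszLin_monomial, liftExp_add, liftExp_add] at h
    have h0 := hu.apply_even_nonneg (β := liftExp α k) (by rw [degree_liftExp]; omega)
    have ih' := ih (by omega)
    rw [liftExp_add] at h0 ih' ⊢
    rw [show (0 : Fin n →₀ ℕ) + (α + α) = α + α from zero_add _,
      show 2 + (k + k) = k + 1 + (k + 1) by ring] at h
    have h1 : τ * u (liftExp (α + α) (k + k)) ≤ |τ| * (|τ| ^ k * v (α + α)) :=
      mul_le_mul (le_abs_self _) ih' h0 (abs_nonneg _)
    rw [pow_succ']
    linarith

theorem exists_bound_of_isFeasible {n : ℕ} (p : MvPolynomial (Fin n) ℝ) (τ : ℝ)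
    (v : (Fin n →₀ ℕ) → ℝ) (d : ℕ) (β : Option (Fin n) →₀ ℕ) :
    ∃ R, ∀ u, IsFeasible p τ v d u → |u β| ≤ R := by
  by_cases hβ : β.degree ≤ 2 * d
  · obtain ⟨β₁, β₂, rfl, h1, h2⟩ := exists_add_eq_degree_le hβ
    obtain ⟨α₁, k₁, rfl⟩ := exists_eq_liftExp β₁
    obtain ⟨α₂, k₂, rfl⟩ := exists_eq_liftExp β₂
    refine ⟨√((|τ| ^ k₁ * v (α₁ + α₁)) * (|τ| ^ k₂ * v (α₂ + α₂))), fun u hu => ?_⟩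
    refine Real.abs_le_sqrt ?_
    have hcs := rieszLin_mul_sq_le hu.moment_psd
      (p := MvPolynomial.monomial (liftExp α₁ k₁) 1) (q := MvPolynomial.monomial (liftExp α₂ k₂) 1)
      ((MvPolynomial.totalDegree_monomial_le _ _).trans h1)
      ((MvPolynomial.totalDegree_monomial_le _ _).trans h2)
    simp only [sq (MvPolynomial.monomial _ _), MvPolynomial.monomial_mul, rieszLin_monomial,
      one_mul] at hcs
    rw [degree_liftExp] at h1 h2
    have hb1 := hu.apply_even_le α₁ k₁ h1
    refine hcs.trans (mul_le_mul hb1 (hu.apply_even_le α₂ k₂ h2)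
      (hu.apply_even_nonneg (by rwa [degree_liftExp]))
      ((hu.apply_even_nonneg (by rwa [degree_liftExp])).trans hb1))
  · exact ⟨0, fun u hu => by rw [hu.eq_zero β (not_le.1 hβ), abs_zero]⟩

theorem isClosed_setOf_localizingMatrix_posSemidef {ι : Type*} (r : ℕ) (p : MvPolynomial ι ℝ) :
    IsClosed {u : (ι →₀ ℕ) → ℝ | (localizingMatrix r p u).PosSemidef} := by
  simp only [localizingMatrix_posSemidef_iff, Set.ofPred_forall]
  exact isClosed_iInter fun q => isClosed_iInter fun _ =>
    isClosed_le continuous_const (continuous_rieszLin _)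

/-- Coordinatewise bounds place the set in a product of compact intervals (Tychonoff), and each
constraint is closed because it involves only finitely many coordinates at a time. -/
theorem isCompact_setOf_isFeasible {n : ℕ} (p : MvPolynomial (Fin n) ℝ) (τ : ℝ)
    (v : (Fin n →₀ ℕ) → ℝ) (d : ℕ) : IsCompact {u | IsFeasible p τ v d u} := by
  choose R hR using exists_bound_of_isFeasible p τ v d
  refine (isCompact_univ_pi fun β => isCompact_Icc (a := -R β) (b := R β)).of_isClosed_subset ?_
    fun u hu β _ => abs_le.1 (hR β u hu)
  have hset : {u | IsFeasible p τ v d u} =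
      (⋂ (β) (_ : 2 * d < β.degree), {u : (Option (Fin n) →₀ ℕ) → ℝ | u β = 0}) ∩
      (⋂ (α : Fin n →₀ ℕ) (_ : α.degree ≤ 2 * d), {u | u (liftExp α 0) = v α}) ∩
      {u | (localizingMatrix d 1 u).PosSemidef} ∩
      {u | localizingMatrix (d - ell p) (theta p) u = 0} ∩
      {u | (localizingMatrix (d - 1) (MvPolynomial.C τ - zVar n ^ 2) u).PosSemidef} ∩
      {u | (localizingMatrix (d - 1) (zVar n) u).PosSemidef} := by
    ext u
    simp only [Set.mem_inter_iff, Set.mem_iInter, Set.mem_ofPred_eq]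
    exact ⟨fun h => ⟨⟨⟨⟨⟨h.1, h.2⟩, h.3⟩, h.4⟩, h.5⟩, h.6⟩,
      fun ⟨⟨⟨⟨⟨h1, h2⟩, h3⟩, h4⟩, h5⟩, h6⟩ => ⟨h1, h2, h3, h4, h5, h6⟩⟩
  rw [hset]
  refine ((((IsClosed.inter ?_ ?_).inter (isClosed_setOf_localizingMatrix_posSemidef _ _)).inter
    ?_).inter (isClosed_setOf_localizingMatrix_posSemidef _ _)).inter
    (isClosed_setOf_localizingMatrix_posSemidef _ _)
  · exact isClosed_iInter fun β => isClosed_iInter fun _ =>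
      isClosed_eq (continuous_apply β) continuous_const
  · exact isClosed_iInter fun α => isClosed_iInter fun _ =>
      isClosed_eq (continuous_apply _) continuous_const
  · refine isClosed_eq (continuous_matrix fun β γ => ?_) continuous_const
    simp only [localizingMatrix_apply]
    exact continuous_rieszLin _

/-! ### Optimal solutions and values -/

theorem exists_isOptimalSup {n : ℕ} {p : MvPolynomial (Fin n) ℝ} {τ : ℝ}
    {v : (Fin n →₀ ℕ) → ℝ} {d : ℕ} (h : ∃ u, IsFeasible p τ v d u) :
    ∃ u, IsOptimalSup p τ v d u := by
  obtain ⟨u, hu, hmax⟩ := (isCompact_setOf_isFeasible p τ v d).exists_isMaxOn h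
    (continuous_apply (liftExp 0 1)).continuousOn
  exact ⟨u, hu, fun u' hu' => hmax hu'⟩

theorem exists_isOptimalInf {n : ℕ} {p : MvPolynomial (Fin n) ℝ} {τ : ℝ}
    {v : (Fin n →₀ ℕ) → ℝ} {d : ℕ} (h : ∃ u, IsFeasible p τ v d u) :
    ∃ u, IsOptimalInf p τ v d u := by
  obtain ⟨u, hu, hmin⟩ := (isCompact_setOf_isFeasible p τ v d).exists_isMinOn h
    (continuous_apply (liftExp 0 1)).continuousOn
  exact ⟨u, hu, fun u' hu' => hmin hu'⟩

theorem IsOptimalSup.upperValue_eq {n : ℕ} {p : MvPolynomial (Fin n) ℝ} {τ : ℝ}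
    {v : (Fin n →₀ ℕ) → ℝ} {d : ℕ} {u : (Option (Fin n) →₀ ℕ) → ℝ}
    (h : IsOptimalSup p τ v d u) : upperValue p τ v d = u (liftExp 0 1) :=
  IsGreatest.csSup_eq ⟨⟨u, h.1, rfl⟩, by rintro _ ⟨w, hw, rfl⟩; exact h.2 w hw⟩

theorem IsOptimalInf.lowerValue_eq {n : ℕ} {p : MvPolynomial (Fin n) ℝ} {τ : ℝ}
    {v : (Fin n →₀ ℕ) → ℝ} {d : ℕ} {u : (Option (Fin n) →₀ ℕ) → ℝ}
    (h : IsOptimalInf p τ v d u) : lowerValue p τ v d = u (liftExp 0 1) :=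
  IsLeast.csInf_eq ⟨⟨u, h.1, rfl⟩, by rintro _ ⟨w, hw, rfl⟩; exact h.2 w hw⟩

theorem IsFeasible.exists_of_le {n : ℕ} {p : MvPolynomial (Fin n) ℝ} {τ : ℝ}
    {v : (Fin n →₀ ℕ) → ℝ} {d e : ℕ} {u : (Option (Fin n) →₀ ℕ) → ℝ} (hu : IsFeasible p τ v e u)
    (hde : d ≤ e) (hd : 1 ≤ d) (hell : ell p ≤ d) :
    ∃ w, IsFeasible p τ v d w ∧ w (liftExp 0 1) = u (liftExp 0 1) := by
  refine ⟨_, hu.truncate hde hd hell, if_pos ?_⟩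
  rw [degree_liftExp, map_zero]
  omega

theorem one_le_dMin {n m : ℕ} (g : Fin m → MvPolynomial (Fin n) ℝ) (j : Fin m) : 1 ≤ dMin g j :=
  le_max_left _ _

theorem ell_le_dMin {n m : ℕ} (g : Fin m → MvPolynomial (Fin n) ℝ) (j : Fin m) :
    ell (g j) ≤ dMin g j :=
  (le_max_right _ _).trans (le_max_right _ _)

/-! ### Measures carried by a compact set -/

theorem integrable_of_continuous_of_ae_mem {E : Type*} [TopologicalSpace E] [MeasurableSpace E]
    [OpensMeasurableSpace E] [T2Space E] {φ : Measure E} [IsFiniteMeasure φ] {K : Set E}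
    (hK : IsCompact K) (hφ : ∀ᵐ x ∂φ, x ∈ K) {f : E → ℝ} (hf : Continuous f) : Integrable f φ := by
  have h := hf.continuousOn.integrableOn_compact (μ := φ) hK
  rwa [IntegrableOn, Measure.restrict_eq_self_of_ae_mem hφ] at h

theorem exists_nonneg_bound_of_isCompact {E : Type*} [TopologicalSpace E] {K : Set E}
    (hK : IsCompact K) {f : E → ℝ} (hf : Continuous f) : ∃ B, 0 ≤ B ∧ ∀ x ∈ K, |f x| ≤ B := by
  obtain ⟨B, hB⟩ := hK.exists_bound_of_continuousOn hf.continuousOn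
  exact ⟨max B 0, le_max_right _ _, fun x hx => (hB x hx).trans (le_max_left _ _)⟩

/-- Stone–Weierstrass for the algebra generated by the coordinate functions. -/
theorem exists_polynomial_near {n : ℕ} {K : Set (EuclideanSpace ℝ (Fin n))} (hK : IsCompact K)
    {f : EuclideanSpace ℝ (Fin n) → ℝ} (hf : Continuous f) {ε : ℝ} (hε : 0 < ε) :
    ∃ p : MvPolynomial (Fin n) ℝ, ∀ x ∈ K, |MvPolynomial.eval (fun i => x i) p - f x| < ε := by
  let X : Fin n → C(EuclideanSpace ℝ (Fin n), ℝ) := fun i => ⟨fun x => x i, by fun_prop⟩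
  have heval : ∀ (p : MvPolynomial (Fin n) ℝ) (x : EuclideanSpace ℝ (Fin n)),
      (MvPolynomial.aeval X p) x = MvPolynomial.eval (fun i => x i) p := by
    intro p x
    induction p using MvPolynomial.induction_on with
    | C a => simp
    | add p q hp hq => simp [hp, hq]
    | mul_X p i hp => simp [hp, X]
  have hsep : (MvPolynomial.aeval X : MvPolynomial (Fin n) ℝ →ₐ[ℝ] _).range.SeparatesPoints := by
    intro x y hxy
    obtain ⟨i, hi⟩ : ∃ i, x i ≠ y i := by
      by_contra! h
      exact hxy (by ext i; exact h i)
    exact ⟨X i, ⟨X i, ⟨MvPolynomial.X i, by simp⟩, rfl⟩, hi⟩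
  obtain ⟨_, ⟨p, rfl⟩, hp⟩ :=
    ContinuousMap.exists_mem_subalgebra_near_continuous_of_isCompact_of_separatesPoints
      hsep ⟨f, hf⟩ hK hε
  refine ⟨p, fun x hx => ?_⟩
  have h := hp x hx
  change ‖(MvPolynomial.aeval X p) x - f x‖ < ε at h
  rwa [heval] at h

/-- A continuous function that is at least `c` on a compact set is approximated there by
polynomials of the form `s ^ 2 + c`. -/
theorem exists_sq_add_near {n : ℕ} {K : Set (EuclideanSpace ℝ (Fin n))} (hK : IsCompact K)
    {f : EuclideanSpace ℝ (Fin n) → ℝ} (hf : Continuous f) {c : ℝ} (hc : ∀ x ∈ K, c ≤ f x)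
    {ε : ℝ} (hε : 0 < ε) : ∃ s : MvPolynomial (Fin n) ℝ, ∀ x ∈ K,
      |MvPolynomial.eval (fun i => x i) (s ^ 2 + MvPolynomial.C c) - f x| ≤ ε := by
  have hr : Continuous fun x => √(f x - c) := by fun_prop
  obtain ⟨A, hA0, hA⟩ := exists_nonneg_bound_of_isCompact hK hr
  -- The cap 1 gives `|y + a| ≤ 2A + 1`; the other bound then gives `|y² - a²| ≤ ε`.
  set η := min 1 (ε / (2 * A + 1)) with hη
  have hη0 : 0 < η := lt_min one_pos (by positivity)
  obtain ⟨s, hs⟩ := exists_polynomial_near hK hr hη0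
  refine ⟨s, fun x hx => ?_⟩
  have h1 := hs x hx
  have h2 := hA x hx
  set a := √(f x - c) with ha
  have h3 : a ^ 2 = f x - c := Real.sq_sqrt (sub_nonneg.2 (hc x hx))
  simp only [map_add, map_pow, MvPolynomial.eval_C]
  set y := MvPolynomial.eval (fun i => x i) s
  have h4 : y ^ 2 + c - f x = (y - a) * (y + a) := by ring_nf; linarith
  have h5 : |y + a| ≤ 2 * A + 1 := by
    calc |y + a| = |(y - a) + 2 * a| := by ring_nf
      _ ≤ |y - a| + |2 * a| := abs_add_le _ _
      _ ≤ 1 + 2 * A := by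
        rw [abs_mul, abs_two]
        have := h1.le.trans (min_le_left _ _)
        linarith
      _ = _ := by ring
  rw [h4, abs_mul]
  calc |y - a| * |y + a| ≤ (ε / (2 * A + 1)) * (2 * A + 1) :=
        mul_le_mul (h1.le.trans (min_le_right _ _)) h5 (abs_nonneg _) (by positivity)
    _ = ε := by field_simp

theorem eval_monomial_eq {n : ℕ} (α : Fin n →₀ ℕ) (x : EuclideanSpace ℝ (Fin n)) :
    MvPolynomial.eval (fun i => x i) (MvPolynomial.monomial α (1 : ℝ)) = ∏ i, x i ^ α i := by
  rw [MvPolynomial.eval_monomial, one_mul, Finsupp.prod_fintype]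
  simp

theorem moment_eq_integral_eval {n : ℕ} (φ : Measure (EuclideanSpace ℝ (Fin n)))
    (α : Fin n →₀ ℕ) :
    moment φ α = ∫ x, MvPolynomial.eval (fun i => x i) (MvPolynomial.monomial α (1 : ℝ)) ∂φ := by
  simp only [eval_monomial_eq]
  rfl

/-- On polynomials in `x` a feasible functional is integration. -/
theorem IsFeasible.rieszLin_rename {n : ℕ} {p : MvPolynomial (Fin n) ℝ} {τ : ℝ}
    {φ : Measure (EuclideanSpace ℝ (Fin n))} [IsFiniteMeasure φ]
    {K : Set (EuclideanSpace ℝ (Fin n))} (hK : IsCompact K) (hφ : ∀ᵐ x ∂φ, x ∈ K) {d : ℕ}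
    {u : (Option (Fin n) →₀ ℕ) → ℝ} (hu : IsFeasible p τ (moment φ) d u)
    {q : MvPolynomial (Fin n) ℝ} (hq : q.totalDegree ≤ 2 * d) :
    rieszLin u (MvPolynomial.rename some q) = ∫ x, MvPolynomial.eval (fun i => x i) q ∂φ := by
  have hterm : ∀ β (x : EuclideanSpace ℝ (Fin n)),
      MvPolynomial.eval (fun i => x i) (MvPolynomial.monomial β (q.coeff β))
        = q.coeff β * MvPolynomial.eval (fun i => x i) (MvPolynomial.monomial β 1) := by
    intro β x
    rw [MvPolynomial.eval_monomial, MvPolynomial.eval_monomial, one_mul]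
  conv_lhs => rw [← q.support_sum_monomial_coeff]
  conv_rhs => rw [← q.support_sum_monomial_coeff]
  simp only [map_sum]
  rw [integral_finsetSum _ fun β _ => integrable_of_continuous_of_ae_mem hK hφ
    (continuous_evalPoly _)]
  refine Finset.sum_congr rfl fun β hβ => ?_
  simp only [hterm]
  rw [integral_const_mul, ← moment_eq_integral_eval, MvPolynomial.rename_monomial,
    rieszLin_monomial, ← liftExp_zero_eq_mapDomain,
    hu.marginal β ((MvPolynomial.le_totalDegree hβ).trans hq)]

/-! ### Convergence of feasible sequences -/

/-- If `q = s² + c` with `c > 0`, then `z - q` is small in the seminorm of a feasible functional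
as soon as `‖∇p‖² - q²` is. -/
theorem IsFeasible.sq_mul_rieszLin_sub_sq_le {n : ℕ} {p : MvPolynomial (Fin n) ℝ} {τ : ℝ}
    {v : (Fin n →₀ ℕ) → ℝ} {d : ℕ} {u : (Option (Fin n) →₀ ℕ) → ℝ} (hu : IsFeasible p τ v d u)
    {c : ℝ} (hc : 0 < c) {S W R : MvPolynomial (Option (Fin n)) ℝ}
    (hW : W = zVar n - (S ^ 2 + MvPolynomial.C c))
    (hR : R = MvPolynomial.rename some (gradSq p) - (S ^ 2 + MvPolynomial.C c) ^ 2)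
    (hd1 : W.totalDegree ≤ d - 1) (hd2 : (S * W).totalDegree ≤ d)
    (hd3 : W.totalDegree ≤ d - ell p) (hd4 : R.totalDegree ≤ d) :
    c ^ 2 * rieszLin u (W ^ 2) ≤ rieszLin u (R ^ 2) := by
  have hA := rieszLin_sq_nonneg hu.moment_psd (p := W) (by omega)
  have hI := rieszLin_sq_nonneg hu.moment_psd hd4
  have hz := (localizingMatrix_posSemidef_iff _ _ _).1 hu.z_psd W hd1
  have hs := rieszLin_sq_nonneg hu.moment_psd hd2
  have ht := rieszLin_mul_eq_zero_of_localizingMatrix_eq_zero hu.theta_zero hd3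
  have hcs := rieszLin_mul_sq_le hu.moment_psd (p := W) (by omega) hd4
  -- This is `(z - q)(z² - q²) - θ W`, with `z + q = z + S² + c` expanded. Under `L_u` the `θ` term
  -- vanishes and the terms in `z` and `S²` are nonnegative.
  have hid : W * R = zVar n * W ^ 2 + (S * W) ^ 2 + c • W ^ 2 - theta p * W := by
    rw [hR, theta, MvPolynomial.smul_eq_C_mul]
    have : zVar n = W + (S ^ 2 + MvPolynomial.C c) := by rw [hW]; ring
    rw [this]
    ring
  have hL : rieszLin u (W * R) = rieszLin u (zVar n * W ^ 2) + rieszLin u ((S * W) ^ 2)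
      + c * rieszLin u (W ^ 2) := by
    rw [hid, map_sub, map_add, map_add, map_smul, ht, sub_zero, smul_eq_mul]
  have hle : c * rieszLin u (W ^ 2) ≤ rieszLin u (W * R) := by linarith
  set A := rieszLin u (W ^ 2)
  have h1 : (c * A) ^ 2 ≤ A * rieszLin u (R ^ 2) :=
    (pow_le_pow_left₀ (by positivity) hle 2).trans hcs
  rcases hA.eq_or_lt with h0 | h0
  · rw [← h0]; simpa using hI
  · refine le_of_mul_le_mul_left ?_ h0
    linarith [show A * (c ^ 2 * A) = (c * A) ^ 2 by ring]

/-- The constant `C` does not depend on `ε`; only the order threshold `D` does, through the degrees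
of the approximating polynomial. -/
theorem exists_bound_apply_liftExp_one {n : ℕ} {p : MvPolynomial (Fin n) ℝ} {τ : ℝ}
    {φ : Measure (EuclideanSpace ℝ (Fin n))} [IsFiniteMeasure φ]
    {K : Set (EuclideanSpace ℝ (Fin n))} (hK : IsCompact K) (hφ : ∀ᵐ x ∂φ, x ∈ K)
    {c : ℝ} (hc : 0 < c) (hgrad : ∀ x ∈ K, c ≤ ‖polyGrad p x‖) (α : Fin n →₀ ℕ) :
    ∃ C, 0 ≤ C ∧ ∀ ε, 0 < ε → ε ≤ 1 → ∃ D, ∀ d, D ≤ d → ∀ u, IsFeasible p τ (moment φ) d u →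
      |u (liftExp α 1) - ∫ x, (∏ i, x i ^ α i) * ‖polyGrad p x‖ ∂φ| ≤ C * ε := by
  set mα : MvPolynomial (Fin n) ℝ := MvPolynomial.monomial α 1 with hmα
  set N : EuclideanSpace ℝ (Fin n) → ℝ := fun x => ‖polyGrad p x‖ with hN
  have hNc : Continuous N := (continuous_polyGrad p).norm
  obtain ⟨B, hB0, hB⟩ := exists_nonneg_bound_of_isCompact hK hNc
  obtain ⟨M, hM0, hM⟩ := exists_nonneg_bound_of_isCompact hK (continuous_evalPoly mα)
  set Φ := φ.real Set.univ with hΦ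
  have hΦ0 : 0 ≤ Φ := measureReal_nonneg
  set V := ∫ x, MvPolynomial.eval (fun i => x i) (mα ^ 2) ∂φ with hV
  have hV0 : 0 ≤ V := integral_nonneg fun x => by simp only [map_pow]; positivity
  -- Cauchy–Schwarz gives `√V · √L_u(W²)` with `√L_u(W²) ≤ ε (2B + 1) √Φ / c`. The further `M * Φ`
  -- below pays for replacing `q` by `‖∇p‖` under the integral.
  set C₀ := √(V * Φ) * (2 * B + 1) / c with hC₀
  have hC₀0 : 0 ≤ C₀ := by positivity
  refine ⟨C₀ + M * Φ, by positivity, fun ε hε hε1 => ?_⟩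
  obtain ⟨s, hs⟩ := exists_sq_add_near hK hNc hgrad hε
  set q := s ^ 2 + MvPolynomial.C c with hq
  set S := MvPolynomial.rename (some : Fin n → Option (Fin n)) s with hS
  set W := zVar n - (S ^ 2 + MvPolynomial.C c) with hW
  have hQ : S ^ 2 + MvPolynomial.C c = MvPolynomial.rename some q := by simp [hq, hS]
  set r := gradSq p - q ^ 2 with hr
  have hR : MvPolynomial.rename some r
      = MvPolynomial.rename some (gradSq p) - (S ^ 2 + MvPolynomial.C c) ^ 2 := by
    rw [hQ, hr, map_sub, map_pow]
  -- A crude sum dominating every degree needed; `1 + ell p` accounts for the localizing orders `d -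
  -- 1` and `d - ell p`.
  refine ⟨1 + ell p + W.totalDegree + (S * W).totalDegree + r.totalDegree + mα.totalDegree
    + (mα * q).totalDegree, fun d hd u hu => ?_⟩
  have hRdeg : (MvPolynomial.rename (some : Fin n → Option (Fin n)) r).totalDegree ≤ d :=
    (MvPolynomial.totalDegree_rename_le _ _).trans (by omega)
  have hmdeg : (MvPolynomial.rename (some : Fin n → Option (Fin n)) mα).totalDegree ≤ d :=
    (MvPolynomial.totalDegree_rename_le _ _).trans (by omega)
  have hmain := hu.sq_mul_rieszLin_sub_sq_le hc hW hR (by omega) (by omega) (by omega) hRdeg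
  have hr2 := MvPolynomial.totalDegree_pow r 2
  have hm2 := MvPolynomial.totalDegree_pow mα 2
  rw [← map_pow, hu.rieszLin_rename hK hφ (q := r ^ 2) (by omega)] at hmain
  -- Factor `r = (N - q)(N + q)`: the first factor is at most `ε`, the second at most `2B + 1`
  -- because `ε ≤ 1`.
  have hI : ∫ x, MvPolynomial.eval (fun i => x i) (r ^ 2) ∂φ ≤ (ε * (2 * B + 1)) ^ 2 * Φ := by
    refine (Real.le_norm_self _).trans (norm_integral_le_of_norm_le_const ?_)
    filter_upwards [hφ] with x hx
    have h1 := hs x hx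
    have h2 := hB x hx
    have h3 : MvPolynomial.eval (fun i => x i) r = (N x - MvPolynomial.eval (fun i => x i) q)
        * (N x + MvPolynomial.eval (fun i => x i) q) := by
      rw [hr, map_sub, eval_gradSq, map_pow]; ring
    rw [map_pow, Real.norm_eq_abs, abs_pow, h3, abs_mul]
    refine pow_le_pow_left₀ (by positivity) (mul_le_mul (by rwa [abs_sub_comm]) ?_
      (abs_nonneg _) hε.le) 2
    set y := MvPolynomial.eval (fun i => x i) q
    calc |N x + y| = |(y - N x) + 2 * N x| := by ring_nf
      _ ≤ |y - N x| + |2 * N x| := abs_add_le _ _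
      _ ≤ 1 + 2 * B := by rw [abs_mul, abs_two]; linarith
      _ = _ := by ring
  have hA := hmain.trans hI
  have hcs := rieszLin_mul_sq_le hu.moment_psd hmdeg (q := W) (by omega)
  rw [← map_pow (MvPolynomial.rename some) mα, hu.rieszLin_rename hK hφ (q := mα ^ 2) (by omega), ← hV] at hcs
  have hfirst : |rieszLin u (MvPolynomial.rename some mα * W)| ≤ C₀ * ε := by
    refine abs_le_of_sq_le_sq ?_ (by positivity)
    refine hcs.trans ?_
    have hsq : (C₀ * ε) ^ 2 = V * (((ε * (2 * B + 1)) ^ 2 * Φ) / c ^ 2) := by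
      rw [hC₀, mul_pow, div_pow, mul_pow, Real.sq_sqrt (by positivity)]
      ring
    rw [hsq]
    refine mul_le_mul_of_nonneg_left ?_ hV0
    rw [le_div_iff₀ (by positivity)]
    linarith
  have hexp : rieszLin u (MvPolynomial.rename some mα * W)
      = u (liftExp α 1) - ∫ x, MvPolynomial.eval (fun i => x i) (mα * q) ∂φ := by
    rw [hW, hQ, mul_sub, map_sub, ← map_mul,
      hu.rieszLin_rename hK hφ (q := mα * q) (by omega), hmα, MvPolynomial.rename_monomial,
      ← liftExp_zero_eq_mapDomain, ← pow_one (zVar n), zVar_pow, MvPolynomial.monomial_mul,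
      liftExp_add, rieszLin_monomial]
    simp
  have hsecond : |(∫ x, MvPolynomial.eval (fun i => x i) (mα * q) ∂φ)
      - ∫ x, (∏ i, x i ^ α i) * N x ∂φ| ≤ M * Φ * ε := by
    simp only [← eval_monomial_eq, ← hmα]
    have hcont : Continuous fun x : EuclideanSpace ℝ (Fin n) =>
        MvPolynomial.eval (fun i => x i) mα * N x := (continuous_evalPoly _).mul hNc
    rw [← integral_sub
      (integrable_of_continuous_of_ae_mem hK hφ (continuous_evalPoly _))
      (integrable_of_continuous_of_ae_mem hK hφ hcont),
      show M * Φ * ε = M * ε * Φ by ring,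
      ← Real.norm_eq_abs]
    refine norm_integral_le_of_norm_le_const ?_
    filter_upwards [hφ] with x hx
    rw [map_mul, ← mul_sub, norm_mul]
    exact mul_le_mul (hM x hx) (hs x hx) (norm_nonneg _) hM0
  rw [hexp] at hfirst
  calc _ ≤ |u (liftExp α 1) - ∫ x, MvPolynomial.eval (fun i => x i) (mα * q) ∂φ|
        + |(∫ x, MvPolynomial.eval (fun i => x i) (mα * q) ∂φ)
          - ∫ x, (∏ i, x i ^ α i) * N x ∂φ| := abs_sub_le _ _ _
    _ ≤ C₀ * ε + M * Φ * ε := add_le_add hfirst hsecond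
    _ = _ := by ring

theorem tendsto_apply_liftExp_one {n : ℕ} {p : MvPolynomial (Fin n) ℝ} {τ : ℝ}
    {φ : Measure (EuclideanSpace ℝ (Fin n))} [IsFiniteMeasure φ]
    {K : Set (EuclideanSpace ℝ (Fin n))} (hK : IsCompact K) (hφ : ∀ᵐ x ∂φ, x ∈ K)
    {c : ℝ} (hc : 0 < c) (hgrad : ∀ x ∈ K, c ≤ ‖polyGrad p x‖)
    {u : ℕ → (Option (Fin n) →₀ ℕ) → ℝ} {d₀ : ℕ}
    (hu : ∀ d, d₀ ≤ d → IsFeasible p τ (moment φ) d (u d)) (α : Fin n →₀ ℕ) :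
    Tendsto (fun d => u d (liftExp α 1)) atTop
      (𝓝 (∫ x, (∏ i, x i ^ α i) * ‖polyGrad p x‖ ∂φ)) := by
  obtain ⟨C, hC0, hC⟩ := exists_bound_apply_liftExp_one (τ := τ) hK hφ hc hgrad α
  rw [Metric.tendsto_atTop]
  intro ε hε
  -- Dividing by `C + 1` covers `C = 0` and makes the final inequality strict.
  have hη : 0 < min 1 (ε / (C + 1)) := lt_min one_pos (by positivity)
  obtain ⟨D, hD⟩ := hC _ hη (min_le_left _ _)
  refine ⟨max D d₀, fun d hd => ?_⟩
  have h := hD d ((le_max_left _ _).trans hd) _ (hu d ((le_max_right _ _).trans hd))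
  rw [Real.dist_eq]
  calc _ ≤ C * min 1 (ε / (C + 1)) := h
    _ < (C + 1) * min 1 (ε / (C + 1)) := by linarith
    _ ≤ (C + 1) * (ε / (C + 1)) := by gcongr; exact min_le_right _ _
    _ = ε := by field_simp

/-! ### The boundary measures -/

theorem ae_mem_boundaryPiece_sigmaPiece {n m : ℕ} {g : Fin m → MvPolynomial (Fin n) ℝ}
    {b : Fin m → ℝ} (hcompact : IsCompact (semialgSet g b)) (j : Fin m) :
    ∀ᵐ x ∂sigmaPiece g b j, x ∈ boundaryPiece g b j :=
  ae_restrict_mem (isCompact_boundaryPiece hcompact j).measurableSet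

theorem ae_mem_boundaryPiece_phiPiece {n m : ℕ} {g : Fin m → MvPolynomial (Fin n) ℝ}
    {b : Fin m → ℝ} (hcompact : IsCompact (semialgSet g b)) (j : Fin m) :
    ∀ᵐ x ∂phiPiece g b j, x ∈ boundaryPiece g b j :=
  (withDensity_absolutelyContinuous _ _).ae_le (ae_mem_boundaryPiece_sigmaPiece hcompact j)

theorem exists_pos_le_norm_polyGrad {n m : ℕ} {g : Fin m → MvPolynomial (Fin n) ℝ}
    {b : Fin m → ℝ} (hcompact : IsCompact (semialgSet g b)) {j : Fin m}
    (hgrad : ∀ x ∈ boundaryPiece g b j, polyGrad (g j) x ≠ 0) :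
    ∃ c, 0 < c ∧ ∀ x ∈ boundaryPiece g b j, c ≤ ‖polyGrad (g j) x‖ := by
  rcases (boundaryPiece g b j).eq_empty_or_nonempty with h | h
  · exact ⟨1, one_pos, by simp [h]⟩
  · obtain ⟨x, hx, hmin⟩ := (isCompact_boundaryPiece hcompact j).exists_isMinOn h
      (continuous_polyGrad (g j)).norm.continuousOn
    exact ⟨_, norm_pos_iff.2 (hgrad x hx), fun y hy => hmin hy⟩

theorem sigmaPiece_univ {n m : ℕ} (g : Fin m → MvPolynomial (Fin n) ℝ)
    (b : Fin m → ℝ) (j : Fin m) :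
    sigmaPiece g b j Set.univ = sigmaPiece g b j (boundaryPiece g b j) := by
  rw [sigmaPiece, Measure.restrict_apply_univ, Measure.restrict_apply_self]

/-- On `Ω_j` the density is at most `1 / c`, and `σ_j` is finite. -/
theorem isFiniteMeasure_phiPiece {n m : ℕ} {g : Fin m → MvPolynomial (Fin n) ℝ}
    {b : Fin m → ℝ} (hcompact : IsCompact (semialgSet g b)) {j : Fin m}
    (hgrad : ∀ x ∈ boundaryPiece g b j, polyGrad (g j) x ≠ 0) :
    IsFiniteMeasure (phiPiece g b j) := by
  obtain ⟨c, hc, hle⟩ := exists_pos_le_norm_polyGrad hcompact hgrad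
  refine isFiniteMeasure_withDensity (ne_of_lt ?_)
  have hbound : ∀ᵐ x ∂sigmaPiece g b j,
      ENNReal.ofReal (1 / ‖polyGrad (g j) x‖) ≤ ENNReal.ofReal (1 / c) := by
    filter_upwards [ae_mem_boundaryPiece_sigmaPiece hcompact j] with x hx
    exact ENNReal.ofReal_le_ofReal (one_div_le_one_div_of_le hc (hle x hx))
  refine (lintegral_mono_ae hbound).trans_lt ?_
  rw [lintegral_const, sigmaPiece_univ]
  exact ENNReal.mul_lt_top ENNReal.ofReal_lt_top (sigmaPiece_boundaryPiece_lt_top hcompact hgrad)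

/-- The factor `‖∇g_j‖` cancels the density of `φ_j`, which identifies the limit as a moment of
`σ_j`. -/
theorem integral_mul_norm_polyGrad_phiPiece {n m : ℕ} {g : Fin m → MvPolynomial (Fin n) ℝ}
    {b : Fin m → ℝ} (hcompact : IsCompact (semialgSet g b)) {j : Fin m}
    (hgrad : ∀ x ∈ boundaryPiece g b j, polyGrad (g j) x ≠ 0) (α : Fin n →₀ ℕ) :
    ∫ x, (∏ i, x i ^ α i) * ‖polyGrad (g j) x‖ ∂phiPiece g b j = moment (sigmaPiece g b j) α := by
  have hmeas : Measurable fun x => Real.toNNReal (1 / ‖polyGrad (g j) x‖) := by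
    have := (continuous_polyGrad (g j)).norm.measurable
    fun_prop
  refine (integral_withDensity_eq_integral_smul hmeas _).trans (integral_congr_ae ?_)
  filter_upwards [ae_mem_boundaryPiece_sigmaPiece hcompact j] with x hx
  have hpos : 0 < ‖polyGrad (g j) x‖ := norm_pos_iff.2 (hgrad x hx)
  rw [NNReal.smul_def, Real.coe_toNNReal _ (by positivity), smul_eq_mul]
  field_simp

theorem moment_sigmaPiece_zero {n m : ℕ} (g : Fin m → MvPolynomial (Fin n) ℝ)
    (b : Fin m → ℝ) (j : Fin m) :
    moment (sigmaPiece g b j) 0 = (sigmaPiece g b j).real (boundaryPiece g b j) := by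
  simp [moment, Measure.real, sigmaPiece_univ]

end BoundaryMoments

end

/-! ### Main theorem -/

theorem mainTheorem2 {n m : ℕ} (g : Fin m → MvPolynomial (Fin n) ℝ) (b : Fin m → ℝ)
    (hcompact : IsCompact (semialgSet g b))
    (hgrad : ∀ k, ∀ x ∈ boundaryPiece g b k, polyGrad (g k) x ≠ 0)
    (j : Fin m) (τ : ℝ) (hτ : ∀ x ∈ boundaryPiece g b j, ‖polyGrad (g j) x‖ ^ 2 < τ)
    (v : (Fin n →₀ ℕ) → ℝ) (hv : ∀ α, v α = moment (phiPiece g b j) α)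
    (hfeas : ∀ d, dMin g j ≤ d → ∃ u, IsFeasible (g j) τ v d u) :
    sigmaPiece g b j (boundaryPiece g b j) < ⊤ ∧
    (∀ d, dMin g j ≤ d → ∃ u, IsOptimalSup (g j) τ v d u) ∧
    (∀ d, dMin g j ≤ d → ∃ w, IsOptimalInf (g j) τ v d w) ∧
    (∀ u : ℕ → (Option (Fin n) →₀ ℕ) → ℝ,
      (∀ d, dMin g j ≤ d → IsOptimalSup (g j) τ v d (u d)) →
        (∀ α, Tendsto (fun d => u d (liftExp α 1)) atTop (𝓝 (moment (sigmaPiece g b j) α))) ∧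
        (∀ d, dMin g j ≤ d → upperValue (g j) τ v d = u d (liftExp 0 1))) ∧
    (∀ w : ℕ → (Option (Fin n) →₀ ℕ) → ℝ,
      (∀ d, dMin g j ≤ d → IsOptimalInf (g j) τ v d (w d)) →
        (∀ α, Tendsto (fun d => w d (liftExp α 1)) atTop (𝓝 (moment (sigmaPiece g b j) α))) ∧
        (∀ d, dMin g j ≤ d → lowerValue (g j) τ v d = w d (liftExp 0 1))) ∧
    AntitoneOn (upperValue (g j) τ v) (Set.Ici (dMin g j)) ∧
    Tendsto (upperValue (g j) τ v) atTop
      (𝓝 ((sigmaPiece g b j).real (boundaryPiece g b j))) ∧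
    MonotoneOn (lowerValue (g j) τ v) (Set.Ici (dMin g j)) ∧
    Tendsto (lowerValue (g j) τ v) atTop
      (𝓝 ((sigmaPiece g b j).real (boundaryPiece g b j))) := by
  obtain rfl : v = moment (phiPiece g b j) := funext hv
  have hK := isCompact_boundaryPiece hcompact j
  obtain ⟨c, hc, hle⟩ := exists_pos_le_norm_polyGrad hcompact (hgrad j)
  have := isFiniteMeasure_phiPiece hcompact (hgrad j)
  have hlim : ∀ u : ℕ → (Option (Fin n) →₀ ℕ) → ℝ,
      (∀ d, dMin g j ≤ d → IsFeasible (g j) τ (moment (phiPiece g b j)) d (u d)) → ∀ α,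
      Tendsto (fun d => u d (liftExp α 1)) atTop (𝓝 (moment (sigmaPiece g b j) α)) := by
    intro u hu α
    rw [← integral_mul_norm_polyGrad_phiPiece hcompact (hgrad j)]
    exact tendsto_apply_liftExp_one hK (ae_mem_boundaryPiece_phiPiece hcompact j) hc hle hu α
  have hsup := fun d hd => exists_isOptimalSup (hfeas d hd)
  have hinf := fun d hd => exists_isOptimalInf (hfeas d hd)
  refine ⟨sigmaPiece_boundaryPiece_lt_top hcompact (hgrad j), hsup, hinf,
    fun u hu => ⟨hlim u fun d hd => (hu d hd).1, fun d hd => (hu d hd).upperValue_eq⟩,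
    fun w hw => ⟨hlim w fun d hd => (hw d hd).1, fun d hd => (hw d hd).lowerValue_eq⟩,
    ?_, ?_, ?_, ?_⟩
  · intro d hd e he hde
    obtain ⟨u, hu⟩ := hsup d hd
    obtain ⟨w, hw⟩ := hsup e he
    -- The truncated order-`e` optimum competes at order `d` with the same objective value.
    obtain ⟨w', hw', heq⟩ := hw.1.exists_of_le hde ((one_le_dMin g j).trans hd)
      ((ell_le_dMin g j).trans hd)
    rw [hu.upperValue_eq, hw.upperValue_eq, ← heq]
    exact hu.2 w' hw'
  -- A selection of optimal solutions has `u_{0,1}` equal to the value from `dMin` on, so the limit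
  -- is the case `α = 0`.
  · choose! u hu using hsup
    rw [← moment_sigmaPiece_zero]
    refine (hlim u (fun d hd => (hu d hd).1) 0).congr' ?_
    filter_upwards [eventually_ge_atTop (dMin g j)] with d hd
    exact (hu d hd).upperValue_eq.symm
  · intro d hd e he hde
    obtain ⟨u, hu⟩ := hinf d hd
    obtain ⟨w, hw⟩ := hinf e he
    obtain ⟨w', hw', heq⟩ := hw.1.exists_of_le hde ((one_le_dMin g j).trans hd)
      ((ell_le_dMin g j).trans hd)
    rw [hu.lowerValue_eq, hw.lowerValue_eq, ← heq]
    exact hu.2 w' hw'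
  · choose! u hu using hinf
    rw [← moment_sigmaPiece_zero]
    refine (hlim u (fun d hd => (hu d hd).1) 0).congr' ?_
    filter_upwards [eventually_ge_atTop (dMin g j)] with d hd
    exact (hu d hd).lowerValue_eq.symm
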